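/- Let $p:\mathcal X\to\mathcal B$ be a proper holomorphic submersion between complex manifolds, with $\dim_{\mathbb C}\mathcal X=\dim_{\mathbb C}\mathcal B+n$, so that $n$ is the dimension of the fibers. For a real $(1,1)$-form $\omega$ with complex structure $J$, put $\langle V,W\rangle_\omega=\omega(V,J\overline W)$; where $\omega$ is positive, $\langle\cdot,\cdot\rangle_\omega$ denotes also the dual metric on (real or complex valued) 1-forms. (1) Let $\omega$ be a real, smooth, $d$-closed $(1,1)$-form on $\mathcal X$ that is positive on every fiber of $p$ (so $p:(\mathcal X,\omega)\to\mathcal B$ is a relative Kähler fibration). Then $\omega$ is Poisson–Kähler, i.e. $\omega^{n+1}\equiv 0$ on $\mathcal X$, if and only if for every open set $U\subset\mathcal B$ and every Kähler form $\omega_U$ on $U$, the form $\omega+p^*\omega_U$ is positive on $p^{-1}(U)$ and $$\langle p^*df,p^*dg\rangle_{\omega+p^*\omega_U}=p^*\langle df,dg\rangle_{\omega_U}\quad\text{on } p^{-1}(U)$$ for all smooth functions $f,g$ on $U$. This holds both with real valued and with complex valued functions $f,g$. (2) Let $\omega_{\mathcal X}$ and $\omega_{\mathcal B}$ be Kähler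 forms on $\mathcal X$ and $\mathcal B$. For a symplectic form $\omega$ and real covectors $\alpha,\beta$ put $\omega(\alpha,\beta):=-\omega(V,W)$, where $V\rfloor\omega=\alpha$ and $W\rfloor\omega=\beta$. Then the following are equivalent: (a) $p$ is a Poisson map, i.e. $\omega_{\mathcal X}(p^*df,p^*dg)=p^*(\omega_{\mathcal B}(df,dg))$ for all smooth real functions $f,g$ on $\mathcal B$; (b) $\langle p^*df,p^*dg\rangle_{\omega_{\mathcal X}}=p^*\langle df,dg\rangle_{\omega_{\mathcal B}}$ for all smooth functions $f,g$ on $\mathcal B$ (equivalently with real valued or with complex valued functions); (c) $p$ is Poisson–Kähler, i.e. $(\omega_{\mathcal X}-p^*\omega_{\mathcal B})^{n+1}\equiv 0$. -/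

import Mathlib

open scoped Manifold ContDiff

namespace PoissonKahler

noncomputable section

/-! A complex manifold is a Hausdorff space `X` charted on a finite-dimensional complex normed
space `E` with `IsManifold 𝓘(ℂ, E) ω X`. Its underlying real tangent space at `x` is
`TangentSpace 𝓘(ℝ, E) x`. -/

/-- The `k`-th exterior power of a real two-form `α`, evaluated on `2k` vectors indexed by
`Fin k × Fin 2` (lexicographic order):
`α^k (v) = 2^{-k} ∑_σ sgn(σ) ∏_i α (v_{σ(i,0)}, v_{σ(i,1)})`. -/
def wedgePow {V : Type*} [AddCommGroup V] [Module ℝ V] [TopologicalSpace V]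
    (α : V [⋀^Fin 2]→L[ℝ] ℝ) (k : ℕ) (v : Fin k × Fin 2 → V) : ℝ :=
  (1 / 2 ^ k) * ∑ σ : Equiv.Perm (Fin k × Fin 2),
    ((Equiv.Perm.sign σ : ℤ) : ℝ) * ∏ i : Fin k, α ![v (σ (i, 0)), v (σ (i, 1))]

section Forms

variable {E : Type*} [NormedAddCommGroup E] [NormedSpace ℂ E]
  {X : Type*} [TopologicalSpace X] [ChartedSpace E X]

/-- The real tangent space of a complex manifold. -/
abbrev RealTangent (E : Type*) [NormedAddCommGroup E] [NormedSpace ℂ E]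
    {X : Type*} [TopologicalSpace X] [ChartedSpace E X] (x : X) : Type _ :=
  TangentSpace 𝓘(ℝ, E) x

/-- The complex structure `J` of the tangent space: multiplication by `i`. -/
def J (E : Type*) [NormedAddCommGroup E] [NormedSpace ℂ E]
    {X : Type*} [TopologicalSpace X] [ChartedSpace E X] (x : X) :
    RealTangent E x →L[ℝ] RealTangent E x :=
  (Complex.I • ContinuousLinearMap.id ℝ E : E →L[ℝ] E)

/-- Real two-forms (no regularity is imposed). -/
abbrev TwoForm (E : Type*) [NormedAddCommGroup E] [NormedSpace ℂ E]
    (X : Type*) [TopologicalSpace X] [ChartedSpace E X] : Type _ :=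
  (x : X) → RealTangent E x [⋀^Fin 2]→L[ℝ] ℝ

/-- The coordinate expression of a two-form in a chart `e`: its pull-back under `e⁻¹`.
It is meaningful on `e.target`. -/
def TwoForm.inChart (Ω : TwoForm E X) (e : OpenPartialHomeomorph X E) (y : E) :
    E [⋀^Fin 2]→L[ℝ] ℝ :=
  (Ω (e.symm y)).compContinuousLinearMap (mfderiv 𝓘(ℝ, E) 𝓘(ℝ, E) e.symm y)

/-- `Ω` is smooth (in the real sense) on the open set `U`. -/
def TwoForm.SmoothOn (Ω : TwoForm E X) (U : Set X) : Prop :=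
  ∀ e ∈ atlas E X, ContDiffOn ℝ ∞ (Ω.inChart e) (e.target ∩ e.symm ⁻¹' U)

/-- `dΩ = 0` on the open set `U`. -/
def TwoForm.ClosedOn (Ω : TwoForm E X) (U : Set X) : Prop :=
  ∀ e ∈ atlas E X, ∀ y ∈ e.target ∩ e.symm ⁻¹' U, extDeriv (Ω.inChart e) y = 0

/-- The real form `Ω` is of bidegree `(1,1)` on `U`: it is `J`-invariant. -/
def TwoForm.IsOneOneOn (Ω : TwoForm E X) (U : Set X) : Prop :=
  ∀ x ∈ U, ∀ v w : RealTangent E x, Ω x ![J E x v, J E x w] = Ω x ![v, w]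

/-- The inner product `⟨v, w⟩_Ω = Ω(v, J w)` on real tangent vectors. -/
def TwoForm.metric (Ω : TwoForm E X) (x : X) (v w : RealTangent E x) : ℝ :=
  Ω x ![v, J E x w]

/-- `Ω` is positive on `U`. -/
def TwoForm.PositiveOn (Ω : TwoForm E X) (U : Set X) : Prop :=
  ∀ x ∈ U, ∀ v : RealTangent E x, v ≠ 0 → 0 < Ω.metric x v v

/-- `Ω` is a Kähler form on the open set `U` (its values outside `U` are irrelevant). -/
structure TwoForm.IsKahlerOn (Ω : TwoForm E X) (U : Set X) : Prop where
  smooth : Ω.SmoothOn U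
  closed : Ω.ClosedOn U
  oneOne : Ω.IsOneOneOn U
  positive : Ω.PositiveOn U

/-- The tangent vector metrically dual to a real covector `α`, that is `⟨V, u⟩_Ω = α(u)` for
all `u`; it exists and is unique where `Ω` is a positive `(1,1)`-form. -/
def TwoForm.sharp (Ω : TwoForm E X) (x : X) (α : RealTangent E x →L[ℝ] ℝ) : RealTangent E x :=
  Classical.epsilon fun V : RealTangent E x => ∀ u : RealTangent E x, Ω.metric x V u = α u

/-- The dual metric on real covectors. -/
def TwoForm.realDualMetric (Ω : TwoForm E X) (x : X) (α β : RealTangent E x →L[ℝ] ℝ) : ℝ :=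
  Ω.metric x (Ω.sharp x α) (Ω.sharp x β)

/-- The dual metric `⟨α, β⟩_Ω` on `𝕜`-valued covectors, `𝕜 = ℝ` or `ℂ`: the sesquilinear
(linear in `α`, conjugate linear in `β`) extension of the dual metric on real covectors. -/
def TwoForm.dualMetric {𝕜 : Type*} [RCLike 𝕜] (Ω : TwoForm E X) (x : X)
    (α β : RealTangent E x →L[ℝ] 𝕜) : 𝕜 :=
  let re : (RealTangent E x →L[ℝ] 𝕜) → (RealTangent E x →L[ℝ] ℝ) := fun γ => RCLike.reCLM.comp γ
  let im : (RealTangent E x →L[ℝ] 𝕜) → (RealTangent E x →L[ℝ] ℝ) := fun γ => RCLike.imCLM.comp γ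
  ((Ω.realDualMetric x (re α) (re β) + Ω.realDualMetric x (im α) (im β) : ℝ) : 𝕜) +
    RCLike.I *
      ((Ω.realDualMetric x (im α) (re β) - Ω.realDualMetric x (re α) (im β) : ℝ) : 𝕜)

/-- The tangent vector `V` with `V ⌟ Ω = α`; it exists and is unique where `Ω` is
non-degenerate. -/
def TwoForm.hamiltonian (Ω : TwoForm E X) (x : X) (α : RealTangent E x →L[ℝ] ℝ) :
    RealTangent E x :=
  Classical.epsilon fun V : RealTangent E x => ∀ u : RealTangent E x, Ω x ![V, u] = α u

/-- The Poisson pairing of covectors: `Ω(α, β) = -Ω(V, W)` where `V ⌟ Ω = α`, `W ⌟ Ω = β`. -/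
def TwoForm.poissonPairing (Ω : TwoForm E X) (x : X) (α β : RealTangent E x →L[ℝ] ℝ) : ℝ :=
  -Ω x ![Ω.hamiltonian x α, Ω.hamiltonian x β]

/-- The differential at `x` of an `𝕜`-valued function, `𝕜 = ℝ` or `ℂ`. -/
def differential {𝕜 : Type*} [RCLike 𝕜] (f : X → 𝕜) (x : X) : RealTangent E x →L[ℝ] 𝕜 :=
  (mfderiv 𝓘(ℝ, E) 𝓘(ℝ, 𝕜) f x : E →L[ℝ] 𝕜)

end Forms

section Maps

variable {E : Type*} [NormedAddCommGroup E] [NormedSpace ℂ E]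
  {F : Type*} [NormedAddCommGroup F] [NormedSpace ℂ F]
  {X : Type*} [TopologicalSpace X] [ChartedSpace E X]
  {B : Type*} [TopologicalSpace B] [ChartedSpace F B]

/-- The real differential `p_* : T_x X → T_{p(x)} B`. -/
def push (E F : Type*) [NormedAddCommGroup E] [NormedSpace ℂ E]
    [NormedAddCommGroup F] [NormedSpace ℂ F]
    {X : Type*} [TopologicalSpace X] [ChartedSpace E X]
    {B : Type*} [TopologicalSpace B] [ChartedSpace F B] (p : X → B) (x : X) :
    RealTangent E x →L[ℝ] RealTangent F (p x) :=
  mfderiv 𝓘(ℝ, E) 𝓘(ℝ, F) p x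

/-- The pull-back `p^* Θ` of a two-form. -/
def TwoForm.pullback (p : X → B) (Θ : TwoForm F B) : TwoForm E X :=
  fun x => (Θ (p x)).compContinuousLinearMap (push E F p x)

/-- Proper holomorphic submersions. -/
structure IsProperHolomorphicSubmersion (E F : Type*) [NormedAddCommGroup E] [NormedSpace ℂ E]
    [NormedAddCommGroup F] [NormedSpace ℂ F]
    {X : Type*} [TopologicalSpace X] [ChartedSpace E X]
    {B : Type*} [TopologicalSpace B] [ChartedSpace F B] (p : X → B) : Prop where
  proper : IsProperMap p
  holomorphic : ContMDiff 𝓘(ℂ, E) 𝓘(ℂ, F) ω p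
  submersion : ∀ x : X, Function.Surjective (push E F p x)

/-- `p : (X, Ω) → B` is a relative Kähler fibration: `p` is a proper holomorphic submersion and
`Ω` is a real smooth `d`-closed `(1,1)`-form, positive on each fibre. The tangent space of the
fibre through `x` is the kernel of `p_*` at `x`. -/
structure IsRelativeKahlerFibration (p : X → B) (Ω : TwoForm E X) : Prop
    extends IsProperHolomorphicSubmersion E F p where
  smooth : Ω.SmoothOn Set.univ
  closed : Ω.ClosedOn Set.univ
  oneOne : Ω.IsOneOneOn Set.univ
  fibrePositive : ∀ (x : X) (v : RealTangent E x), push E F p x v = 0 → v ≠ 0 →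
    0 < Ω.metric x v v

/-- `Ω` is Poisson–Kähler, `n` being the complex dimension of the fibres: it solves the homogeneous
Monge–Ampère equation `Ω^{n+1} ≡ 0`. -/
def IsPoissonKahler (Ω : TwoForm E X) (n : ℕ) : Prop :=
  ∀ (x : X) (v : Fin (n + 1) × Fin 2 → RealTangent E x), wedgePow (Ω x) (n + 1) v = 0

/-- `p : (p⁻¹(U), Ω) → (U, Θ)` preserves the dual metrics:
`⟨p^*df, p^*dg⟩_Ω = p^*⟨df, dg⟩_Θ` for all smooth `𝕜`-valued functions `f, g` on `U`. -/
def IsMetricPoissonOn (𝕜 : Type*) [RCLike 𝕜] (p : X → B) (U : Set B)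
    (Ω : TwoForm E X) (Θ : TwoForm F B) : Prop :=
  ∀ f g : B → 𝕜, ContMDiffOn 𝓘(ℝ, F) 𝓘(ℝ, 𝕜) ∞ f U → ContMDiffOn 𝓘(ℝ, F) 𝓘(ℝ, 𝕜) ∞ g U →
    ∀ x ∈ p ⁻¹' U,
      Ω.dualMetric x ((differential f (p x)).comp (push E F p x))
          ((differential g (p x)).comp (push E F p x)) =
        Θ.dualMetric (p x) (differential f (p x)) (differential g (p x))

/-- `p : (X, Ω) → (B, Θ)` is a Poisson map of symplectic manifolds:
`Ω(p^*df, p^*dg) = p^*(Θ(df, dg))` for all smooth real functions `f, g` on `B`. -/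
def IsPoissonMap (p : X → B) (Ω : TwoForm E X) (Θ : TwoForm F B) : Prop :=
  ∀ f g : B → ℝ, ContMDiff 𝓘(ℝ, F) 𝓘(ℝ, ℝ) ∞ f → ContMDiff 𝓘(ℝ, F) 𝓘(ℝ, ℝ) ∞ g → ∀ x : X,
    Ω.poissonPairing x ((differential f (p x)).comp (push E F p x))
        ((differential g (p x)).comp (push E F p x)) =
      Θ.poissonPairing (p x) (differential f (p x)) (differential g (p x))

end Maps

end

end PoissonKahler

open PoissonKahler

/-!
The statement is one about linear algebra at each point `x` of the total space. Let `A` be the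
differential of `p` at `x`, a surjective complex-linear map whose kernel has dimension `n`, and let
`η` be a real `(1,1)`-form that is positive on this kernel. Call a vector horizontal if `η` pairs it
to zero with the kernel; every vector is the sum of a vertical and a horizontal one. All conditions
of the theorem turn out to say that `η` vanishes on horizontal vectors (`IsHorizontallyFlat`).

* `η ^ (n + 1) = 0` says so by `pfaffian_eq_zero_iff_isHorizontallyFlat`: if `η` only sees vertical
  components, then `η ^ (n + 1)` is an alternating form on a space of real dimension `2n`, and
  otherwise it does not vanish on a unitary basis of the kernel together with `v` and `iv`, for a
  horizontal `v` with `η(v, iv) ≠ 0`.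
* Let `θ` be a positive `(1,1)`-form on the target such that `η + A^* θ` is positive, which is
  automatic if `η` vanishes on horizontal vectors. The vectors dual to pulled-back covectors are
  exactly the horizontal ones, and pulling back preserves the dual metrics if and only if `A` is
  isometric on them, that is, `η(v, iv) = 0` (`isHorizontallyFlat_iff_formDual`).
* The Poisson pairing of `α` and `β ∘ i` is the dual metric of `α` and `β`
  (`formPoisson_comp_mulI`), so the Poisson condition is equivalent to the metric one.

Two facts about manifolds connect this with the statement. Every covector at a point of the base is
the differential of a global smooth function (`exists_contMDiff_differential_eq`), so the conditions
on functions are conditions on covectors, for real and complex values alike. And every point of the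
base has a neighbourhood carrying a Kähler form (`exists_isKahlerOn`), so that the metric condition
for all open sets and Kähler forms is not vacuous at any point.
-/

namespace PoissonKahler

/-! ### Exterior powers of a two-form as Pfaffians -/

section Pfaffian

variable {V : Type*} [AddCommGroup V] [Module ℝ V]

/-- The product `∏ i, η (v (i, 0)) (v (i, 1))` as a multilinear map in the `2k` vectors `v`. -/
def pairProd (η : V →ₗ[ℝ] V →ₗ[ℝ] ℝ) (k : ℕ) :
    MultilinearMap ℝ (fun _ : Fin k × Fin 2 => V) ℝ :=
  MultilinearMap.mk' (fun v => ∏ i : Fin k, η (v (i, 0)) (v (i, 1)))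
    (by
      intro v ⟨j, b⟩ x y
      rw [← Finset.mul_prod_erase _ _ (Finset.mem_univ j),
        ← Finset.mul_prod_erase _ _ (Finset.mem_univ j),
        ← Finset.mul_prod_erase _ _ (Finset.mem_univ j)]
      have h : ∀ z, ∏ i ∈ Finset.univ.erase j,
          η (Function.update v (j, b) z (i, 0)) (Function.update v (j, b) z (i, 1)) =
          ∏ i ∈ Finset.univ.erase j, η (v (i, 0)) (v (i, 1)) := by
        intro z
        refine Finset.prod_congr rfl fun i hi => ?_
        have hij : i ≠ j := Finset.ne_of_mem_erase hi
        simp [Function.update_of_ne, hij]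
      rw [h, h, h, ← add_mul]
      congr 1
      fin_cases b <;> simp)
    (by
      intro v ⟨j, b⟩ c x
      rw [← Finset.mul_prod_erase _ _ (Finset.mem_univ j),
        ← Finset.mul_prod_erase _ _ (Finset.mem_univ j)]
      have h : ∀ z, ∏ i ∈ Finset.univ.erase j,
          η (Function.update v (j, b) z (i, 0)) (Function.update v (j, b) z (i, 1)) =
          ∏ i ∈ Finset.univ.erase j, η (v (i, 0)) (v (i, 1)) := by
        intro z
        refine Finset.prod_congr rfl fun i hi => ?_
        have hij : i ≠ j := Finset.ne_of_mem_erase hi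
        simp [Function.update_of_ne, hij]
      rw [h, h, smul_eq_mul, ← mul_assoc]
      congr 1
      fin_cases b <;> simp)

/-- The alternatization of `∏ i, η (v (i, 0)) (v (i, 1))`. It is `2 ^ k` times `η ^ k`; the
factor is dropped since only vanishing matters. -/
noncomputable def pfaffian (η : V →ₗ[ℝ] V →ₗ[ℝ] ℝ) (k : ℕ) :
    V [⋀^Fin k × Fin 2]→ₗ[ℝ] ℝ :=
  MultilinearMap.alternatization (pairProd η k)

theorem pfaffian_apply (η : V →ₗ[ℝ] V →ₗ[ℝ] ℝ) (k : ℕ) (v : Fin k × Fin 2 → V) :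
    pfaffian η k v = ∑ σ : Equiv.Perm (Fin k × Fin 2),
      ((Equiv.Perm.sign σ : ℤ) : ℝ) * ∏ i : Fin k, η (v (σ (i, 0))) (v (σ (i, 1))) := by
  rw [pfaffian, MultilinearMap.alternatization_apply]
  refine Finset.sum_congr rfl fun σ _ => ?_
  rw [Units.smul_def, zsmul_eq_mul]
  rfl

/-- If `η` only sees the components of its arguments in a subspace of dimension less than `2k`,
then `η ^ k = 0`: an alternating map vanishes on linearly dependent vectors. -/
theorem pfaffian_eq_zero_of_factors (η : V →ₗ[ℝ] V →ₗ[ℝ] ℝ) (k : ℕ) (K : Submodule ℝ V)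
    [FiniteDimensional ℝ K] (hK : Module.finrank ℝ K < 2 * k) (π : V → V) (hπ : ∀ v, π v ∈ K)
    (h : ∀ v w, η v w = η (π v) (π w)) (v : Fin k × Fin 2 → V) : pfaffian η k v = 0 := by
  have h1 : pfaffian η k v = pfaffian η k (fun i => π (v i)) := by
    simp only [pfaffian_apply, h (v _)]
  rw [h1]
  refine AlternatingMap.map_linearDependent _ _ fun hli => ?_
  have hli' : LinearIndependent ℝ (fun i => (⟨π (v i), hπ _⟩ : K)) :=
    LinearIndependent.of_comp K.subtype hli
  have := hli'.fintype_card_le_finrank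
  simp at this
  omega

/-- For vectors arranged in mutually `η`-orthogonal pairs, a permutation contributes to the
Pfaffian only if it maps pairs to pairs. Its contribution is then the product over the pairs:
permuting whole pairs is an even permutation, and exchanging the members of a pair changes both the
sign of the permutation and that of the factor. -/
theorem prod_pairing_of_orthogonal {η : V →ₗ[ℝ] V →ₗ[ℝ] ℝ} (hη : η.IsAlt) {k : ℕ}
    {v : Fin k × Fin 2 → V} (hv : ∀ i j a b, i ≠ j → η (v (i, a)) (v (j, b)) = 0)
    (σ : Equiv.Perm (Fin k × Fin 2)) :
    ((Equiv.Perm.sign σ : ℤ) : ℝ) * ∏ i : Fin k, η (v (σ (i, 0))) (v (σ (i, 1))) = 0 ∨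
    ((Equiv.Perm.sign σ : ℤ) : ℝ) * ∏ i : Fin k, η (v (σ (i, 0))) (v (σ (i, 1))) =
      ∏ i : Fin k, η (v (i, 0)) (v (i, 1)) := by
  by_cases hσ : ∃ i, (σ (i, 0)).1 ≠ (σ (i, 1)).1
  · obtain ⟨i, hi⟩ := hσ
    left
    rw [Finset.prod_eq_zero (Finset.mem_univ i) (hv _ _ _ _ hi), mul_zero]
  right
  push Not at hσ
  have hne : ∀ i, (σ (i, 0)).2 ≠ (σ (i, 1)).2 := fun i h => by
    have := σ.injective (Prod.ext (hσ i) h)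
    simp at this
  have hπ : Function.Injective fun i => (σ (i, 0)).1 := by
    intro i j hij
    simp only at hij
    by_contra hne'
    have h0 : ∀ c : Fin 2, c = (σ (i, 0)).2 ∨ c = (σ (i, 1)).2 := by
      intro c
      have := hne i
      omega
    rcases h0 (σ (j, 0)).2 with h | h
    · exact hne' (Prod.ext_iff.1 (σ.injective (Prod.ext hij.symm h))).1.symm
    · exact hne' (Prod.ext_iff.1 (σ.injective
        (Prod.ext (hij.symm.trans (hσ i)) h : σ (j, 0) = σ (i, 1)))).1.symm
  -- `σ` permutes the pairs by `π`, after a permutation `τ i` inside each pair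
  let π : Equiv.Perm (Fin k) := Equiv.ofBijective _ (Finite.injective_iff_bijective.1 hπ)
  have hτ : ∀ i, Function.Injective fun b => (σ (i, b)).2 := by
    intro i a b hab
    fin_cases a <;> fin_cases b
    · rfl
    · exact (hne i hab).elim
    · exact (hne i hab.symm).elim
    · rfl
  let τ : Fin k → Equiv.Perm (Fin 2) := fun i =>
    Equiv.ofBijective _ (Finite.injective_iff_bijective.1 (hτ i))
  have hfac : σ = (Equiv.prodCongrLeft fun _ : Fin 2 => π) * Equiv.prodCongrRight τ := by
    ext1 ⟨i, b⟩
    refine Prod.ext ?_ rfl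
    change (σ (i, b)).1 = (σ (i, 0)).1
    fin_cases b
    · rfl
    · exact (hσ i).symm
  have hsign : ((Equiv.Perm.sign σ : ℤ) : ℝ) = ∏ i, ((Equiv.Perm.sign (τ i) : ℤ) : ℝ) := by
    rw [hfac, Equiv.Perm.sign_mul, Equiv.Perm.sign_prodCongrLeft, Equiv.Perm.sign_prodCongrRight]
    simp
  rw [hsign, ← Finset.prod_mul_distrib, ← Equiv.prod_comp π fun i => η (v (i, 0)) (v (i, 1))]
  refine Finset.prod_congr rfl fun i _ => ?_
  have e0 : σ (i, 0) = (π i, τ i 0) := rfl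
  have e1 : σ (i, 1) = (π i, τ i 1) := Prod.ext (hσ i).symm rfl
  rw [e0, e1]
  rcases (by decide : ∀ t : Equiv.Perm (Fin 2), t = 1 ∨ t = Equiv.swap 0 1) (τ i) with h | h
  · simp [h]
  · simp [h, ← hη.neg (v (π i, 0))]

theorem pfaffian_ne_zero_of_orthogonal {η : V →ₗ[ℝ] V →ₗ[ℝ] ℝ} (hη : η.IsAlt) {k : ℕ}
    {v : Fin k × Fin 2 → V} (hv : ∀ i j a b, i ≠ j → η (v (i, a)) (v (j, b)) = 0)
    (h : ∀ i, η (v (i, 0)) (v (i, 1)) ≠ 0) : pfaffian η k v ≠ 0 := by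
  set P := ∏ i : Fin k, η (v (i, 0)) (v (i, 1)) with hP
  have hP0 : P ≠ 0 := Finset.prod_ne_zero_iff.2 fun i _ => h i
  -- every permutation contributes `0` or `P ^ 2`, and the identity contributes `P ^ 2`
  have hpos : 0 < pfaffian η k v * P := by
    rw [pfaffian_apply, Finset.sum_mul]
    refine Finset.sum_pos' (fun σ _ => ?_) ⟨1, Finset.mem_univ _, ?_⟩
    · rcases prod_pairing_of_orthogonal hη hv σ with h | h
      · rw [h, zero_mul]
      · rw [h]; exact mul_self_nonneg _
    · simp only [Equiv.Perm.sign_one, Units.val_one, Int.cast_one, one_mul, Equiv.Perm.one_apply]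
      exact mul_self_pos.2 hP0
  exact fun h0 => by simp [h0] at hpos

end Pfaffian

/-! ### Positive (1,1)-forms on a complex vector space -/

section OneOne

variable {V : Type*} [AddCommGroup V] [Module ℂ V]

/-- A real bilinear form on a complex vector space is a real `(1,1)`-form if it is alternating and
invariant under multiplication by `i`. -/
structure IsOneOneForm (η : V →ₗ[ℝ] V →ₗ[ℝ] ℝ) : Prop where
  alt : η.IsAlt
  invariant : ∀ v w, η (Complex.I • v) (Complex.I • w) = η v w

namespace IsOneOneForm

variable {η : V →ₗ[ℝ] V →ₗ[ℝ] ℝ}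

theorem I_smul_left (h : IsOneOneForm η) (v w : V) :
    η (Complex.I • v) w = -η v (Complex.I • w) := by
  have := h.invariant v (Complex.I • w)
  rw [smul_smul, Complex.I_mul_I, neg_one_smul, map_neg] at this
  linarith

theorem apply_I_smul_comm (h : IsOneOneForm η) (v w : V) :
    η v (Complex.I • w) = η w (Complex.I • v) := by
  rw [← neg_neg (η v _), ← h.I_smul_left, h.alt.neg]

end IsOneOneForm

theorem complex_smul_eq (c : ℂ) (v : V) : c • v = c.re • v + c.im • (Complex.I • v) := by
  conv_lhs => rw [← Complex.re_add_im c, add_smul, mul_smul]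
  rfl

/-- A positive `(1,1)`-form admits a unitary basis, that is, an orthonormal basis of the Hermitian
product `η(v, iw) + i η(v, w)`. -/
theorem IsOneOneForm.exists_orthonormal {η : V →ₗ[ℝ] V →ₗ[ℝ] ℝ} (h : IsOneOneForm η)
    [FiniteDimensional ℂ V] (hpos : ∀ v, v ≠ 0 → 0 < η v (Complex.I • v)) :
    ∃ e : Fin (Module.finrank ℂ V) → V, (∀ i, η (e i) (Complex.I • e i) = 1) ∧
      ∀ i j, i ≠ j → η (e i) (e j) = 0 ∧ η (e i) (Complex.I • e j) = 0 := by
  let core : InnerProductSpace.Core ℂ V :=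
    { inner := fun v w => ⟨η v (Complex.I • w), η v w⟩
      conj_inner_symm := fun v w => by
        apply Complex.ext
        · simpa using h.apply_I_smul_comm w v
        · simpa using h.alt.neg w v
      re_inner_nonneg := fun v => by
        rcases eq_or_ne v 0 with rfl | hv
        · simp
        · exact (hpos v hv).le
      add_left := fun u v w => by apply Complex.ext <;> simp
      smul_left := fun v w c => by
        rw [complex_smul_eq]
        apply Complex.ext
        · simp [h.invariant]
        · simp [h.I_smul_left]
      definite := fun v hv => by
        by_contra hne
        exact (hpos v hne).ne' (congrArg Complex.re hv) }
  let : NormedAddCommGroup V := core.toNormedAddCommGroup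
  let : InnerProductSpace ℂ V := InnerProductSpace.ofCore core.toCore
  let b := stdOrthonormalBasis ℂ V
  have hb : ∀ i j, (⟨η (b i) (Complex.I • b j), η (b i) (b j)⟩ : ℂ) = if i = j then 1 else 0 :=
    fun i j => orthonormal_iff_ite.1 b.orthonormal i j
  refine ⟨b, fun i => ?_, fun i j hij => ?_⟩
  · have := congrArg Complex.re (hb i i)
    simpa using this
  · have h' := hb i j
    rw [if_neg hij] at h'
    exact ⟨congrArg Complex.im h', congrArg Complex.re h'⟩

/-- A positive form is non-degenerate, so it represents every linear functional. -/
theorem exists_represents [FiniteDimensional ℂ V] {η : V →ₗ[ℝ] V →ₗ[ℝ] ℝ}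
    (hpos : ∀ v, v ≠ 0 → 0 < η v (Complex.I • v)) (α : V →ₗ[ℝ] ℝ) : ∃ v, ∀ u, η v u = α u := by
  have : FiniteDimensional ℝ V := FiniteDimensional.complexToReal V
  have hinj : Function.Injective η := (injective_iff_map_eq_zero η).2 fun v hv => by
    by_contra hne
    exact (hpos v hne).ne' (by rw [hv]; rfl)
  have hsurj : Function.Surjective η :=
    (LinearMap.injective_iff_surjective_of_finrank_eq_finrank
      (Subspace.dual_finrank_eq (K := ℝ) (V := V)).symm).1 hinj
  obtain ⟨v, hv⟩ := hsurj α
  exact ⟨v, fun u => by rw [hv]⟩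

/-- The vector `v` with `η(v, iu) = α u` for all `u`; it exists and is unique if `η` is positive. -/
noncomputable def formSharp (η : V →ₗ[ℝ] V →ₗ[ℝ] ℝ) (α : V →ₗ[ℝ] ℝ) : V :=
  Classical.epsilon fun v => ∀ u, η v (Complex.I • u) = α u

/-- The metric on real covectors dual to `η(v, iw)`. -/
noncomputable def formDual (η : V →ₗ[ℝ] V →ₗ[ℝ] ℝ) (α β : V →ₗ[ℝ] ℝ) : ℝ :=
  η (formSharp η α) (Complex.I • formSharp η β)

/-- The vector `v` with `η(v, u) = α u` for all `u`; it exists and is unique if `η` is positive. -/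
noncomputable def formHamiltonian (η : V →ₗ[ℝ] V →ₗ[ℝ] ℝ) (α : V →ₗ[ℝ] ℝ) : V :=
  Classical.epsilon fun v => ∀ u, η v u = α u

/-- The Poisson pairing of real covectors. -/
noncomputable def formPoisson (η : V →ₗ[ℝ] V →ₗ[ℝ] ℝ) (α β : V →ₗ[ℝ] ℝ) : ℝ :=
  -η (formHamiltonian η α) (formHamiltonian η β)

/-- Multiplication by `I` as a real-linear map. -/
def mulI (V : Type*) [AddCommGroup V] [Module ℂ V] : V →ₗ[ℝ] V :=
  (Complex.I • LinearMap.id : V →ₗ[ℂ] V).restrictScalars ℝ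

@[simp] theorem mulI_apply (v : V) : mulI V v = Complex.I • v := rfl

theorem eq_of_pairing_eq {η : V →ₗ[ℝ] V →ₗ[ℝ] ℝ} (hpos : ∀ v, v ≠ 0 → 0 < η v (Complex.I • v))
    {v w : V} (h : ∀ u, η v u = η w u) : v = w := by
  by_contra hne
  have := hpos (v - w) (sub_ne_zero.2 hne)
  rw [map_sub, LinearMap.sub_apply, h, sub_self] at this
  exact this.false

section Positive

variable [FiniteDimensional ℂ V] {η : V →ₗ[ℝ] V →ₗ[ℝ] ℝ}
  (hpos : ∀ v, v ≠ 0 → 0 < η v (Complex.I • v))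
include hpos

theorem formHamiltonian_spec (α : V →ₗ[ℝ] ℝ) (u : V) : η (formHamiltonian η α) u = α u :=
  Classical.epsilon_spec (exists_represents hpos α) u

theorem formSharp_spec (α : V →ₗ[ℝ] ℝ) (u : V) : η (formSharp η α) (Complex.I • u) = α u := by
  refine Classical.epsilon_spec (p := fun v => ∀ u, η v (Complex.I • u) = α u) ?_ u
  obtain ⟨v, hv⟩ := exists_represents hpos (-(α ∘ₗ mulI V))
  refine ⟨v, fun u => ?_⟩
  rw [hv]
  simp [smul_smul]

theorem formDual_eq (α β : V →ₗ[ℝ] ℝ) : formDual η α β = α (formSharp η β) :=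
  formSharp_spec hpos α _

theorem eq_formSharp {α : V →ₗ[ℝ] ℝ} {v : V} (h : ∀ u, η v (Complex.I • u) = α u) :
    v = formSharp η α := by
  refine eq_of_pairing_eq hpos fun u => ?_
  have hu : u = Complex.I • (-(Complex.I • u)) := by simp [smul_smul]
  rw [hu, h, formSharp_spec hpos]

/-- The Poisson pairing is the dual metric twisted by the complex structure: the vector dual to `β`
in the metric sense is `i` times its Hamiltonian vector. -/
theorem formPoisson_comp_mulI (h : IsOneOneForm η) (α β : V →ₗ[ℝ] ℝ) :
    formPoisson η α (β ∘ₗ mulI V) = formDual η α β := by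
  have h1 : formSharp η β = Complex.I • formHamiltonian η β :=
    (eq_formSharp hpos fun u => by rw [h.invariant, formHamiltonian_spec hpos]).symm
  have h2 : formHamiltonian η (β ∘ₗ mulI V) = -formSharp η β := by
    refine eq_of_pairing_eq hpos fun u => ?_
    rw [formHamiltonian_spec hpos, h1, map_neg, LinearMap.neg_apply, h.I_smul_left,
      formHamiltonian_spec hpos]
    simp
  rw [formPoisson, h2, map_neg, neg_neg, formHamiltonian_spec hpos, formDual_eq hpos]

end Positive

end OneOne

/-! ### A (1,1)-form and a surjective linear map -/

section Submersion

variable {V : Type*} [AddCommGroup V] [Module ℂ V]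
  {W : Type*} [AddCommGroup W] [Module ℂ W]
  (A : V →ₗ[ℂ] W) (η : V →ₗ[ℝ] V →ₗ[ℝ] ℝ) (θ : W →ₗ[ℝ] W →ₗ[ℝ] ℝ)

/-- A vector is horizontal if `η` pairs it to zero with the kernel of `A`. -/
def IsHorizontal (v : V) : Prop := ∀ k, A k = 0 → η v k = 0

/-- The form `η` vanishes on horizontal vectors. Only the associated quadratic form is mentioned;
for a `(1,1)`-form this suffices, by polarization. -/
def IsHorizontallyFlat : Prop :=
  ∀ v, IsHorizontal A η v → η v (Complex.I • v) = 0

/-- The pull-back of a bilinear form under a complex-linear map. -/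
def pullbackForm : V →ₗ[ℝ] V →ₗ[ℝ] ℝ :=
  θ.compl₁₂ (A.restrictScalars ℝ) (A.restrictScalars ℝ)

@[simp] theorem pullbackForm_apply (v w : V) : pullbackForm A θ v w = θ (A v) (A w) := rfl

variable {A η θ}

theorem IsOneOneForm.pullbackForm (h : IsOneOneForm θ) : IsOneOneForm (pullbackForm A θ) where
  alt v := h.alt (A v)
  invariant v w := by simp [h.invariant]

theorem IsOneOneForm.sub {η' : V →ₗ[ℝ] V →ₗ[ℝ] ℝ} (h : IsOneOneForm η) (h' : IsOneOneForm η') :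
    IsOneOneForm (η - η') where
  alt v := by simp [h.alt v, h'.alt v]
  invariant v w := by simp [h.invariant, h'.invariant]

theorem IsHorizontal.I_smul (h : IsOneOneForm η) {v : V} (hv : IsHorizontal A η v) :
    IsHorizontal A η (Complex.I • v) := fun k hk => by
  rw [h.I_smul_left, hv _ (by rw [map_smul, hk, smul_zero]), neg_zero]

theorem IsHorizontal.add {v w : V} (hv : IsHorizontal A η v) (hw : IsHorizontal A η w) :
    IsHorizontal A η (v + w) := fun k hk => by
  rw [map_add, LinearMap.add_apply, hv k hk, hw k hk, add_zero]

theorem IsHorizontallyFlat.apply_eq_zero (h : IsOneOneForm η) (hflat : IsHorizontallyFlat A η)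
    {v w : V} (hv : IsHorizontal A η v) (hw : IsHorizontal A η w) : η v w = 0 := by
  have key : ∀ w, IsHorizontal A η w → η v (Complex.I • w) = 0 := fun w hw => by
    have h1 := hflat _ (hv.add hw)
    simp only [smul_add, map_add, LinearMap.add_apply, hflat v hv, hflat w hw,
      h.apply_I_smul_comm w v] at h1
    linarith
  have := key _ (hw.I_smul h)
  rw [smul_smul, Complex.I_mul_I, neg_one_smul, map_neg] at this
  linarith

/-- A form that is positive on the kernel of `A` is non-degenerate there, so every vector is the
sum of a horizontal and a vertical one. -/
theorem exists_horizontal_add_vertical [FiniteDimensional ℂ V]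
    (hfib : ∀ v, A v = 0 → v ≠ 0 → 0 < η v (Complex.I • v)) (v : V) :
    ∃ k, A k = 0 ∧ IsHorizontal A η (v - k) := by
  let i := A.ker.subtype.restrictScalars ℝ
  obtain ⟨k, hk⟩ := exists_represents (V := A.ker) (η := η.compl₁₂ i i)
    (fun k hk => hfib k k.2 (by simpa using hk)) (η v ∘ₗ i)
  refine ⟨k, k.2, fun u hu => ?_⟩
  have := hk ⟨u, hu⟩
  rw [map_sub, LinearMap.sub_apply, sub_eq_zero]
  exact this.symm

/-- A horizontally flat form pairs horizontal vectors to zero with everything. -/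
theorem IsHorizontallyFlat.apply_horizontal_left [FiniteDimensional ℂ V]
    (hfib : ∀ v, A v = 0 → v ≠ 0 → 0 < η v (Complex.I • v)) (hη : IsOneOneForm η)
    (hflat : IsHorizontallyFlat A η) {v : V} (hv : IsHorizontal A η v) (w : V) : η v w = 0 := by
  obtain ⟨k, hk, hw⟩ := exists_horizontal_add_vertical hfib w
  rw [← sub_add_cancel w k, map_add, hv k hk, hflat.apply_eq_zero hη hv hw, add_zero]

/-- With `n` the dimension of the kernel of `A`, the form `η ^ (n + 1)` vanishes if and only if `η`
vanishes on horizontal vectors. In one direction, `η` then only sees vertical components. In the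
other, a horizontal `v` with `η(v, iv) ≠ 0` and a unitary basis of the kernel form `n + 1`
orthogonal pairs on which `η ^ (n + 1)` is not zero. -/
theorem pfaffian_eq_zero_iff_isHorizontallyFlat [FiniteDimensional ℂ V]
    (hfib : ∀ v, A v = 0 → v ≠ 0 → 0 < η v (Complex.I • v)) (hη : IsOneOneForm η) {n : ℕ}
    (hn : Module.finrank ℂ A.ker = n) :
    (∀ v, pfaffian η (n + 1) v = 0) ↔ IsHorizontallyFlat A η := by
  constructor
  · intro h0 v hv
    by_contra hne
    let i := A.ker.subtype.restrictScalars ℝ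
    have hi : IsOneOneForm (η.compl₁₂ i i) :=
      ⟨fun k => hη.alt (k : V), fun k l => hη.invariant (k : V) l⟩
    obtain ⟨e, he, he'⟩ := hi.exists_orthonormal (fun k hk => hfib k k.2 (by simpa using hk))
    subst hn
    -- the pairs are `(f j, i f j)`, where `f` is `v` followed by a unitary basis of the kernel
    let f : Fin (Module.finrank ℂ A.ker + 1) → V := Fin.cons v fun j => (e j : V)
    have hker : ∀ j, A (e j : V) = 0 := fun j => (e j).2
    have hf : ∀ j l, j ≠ l → η (f j) (f l) = 0 ∧ η (f j) (Complex.I • f l) = 0 := by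
      intro j l hjl
      induction j using Fin.cases with
      | zero =>
        induction l using Fin.cases with
        | zero => exact (hjl rfl).elim
        | succ l =>
          exact ⟨hv _ (hker l), hv _ (by rw [map_smul]; exact smul_eq_zero_of_right _ (hker l))⟩
      | succ j =>
        induction l using Fin.cases with
        | zero =>
          constructor
          · change η (e j) v = 0
            rw [← hη.alt.neg, hv _ (hker j), neg_zero]
          · change η (e j) (Complex.I • v) = 0
            rw [hη.apply_I_smul_comm, ← neg_neg (η _ _), ← hη.I_smul_left,
              hv.I_smul hη _ (hker j), neg_zero]
        | succ l => exact he' j l fun h => hjl (by rw [h])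
    refine pfaffian_ne_zero_of_orthogonal hη.alt
      (v := fun p => ![f p.1, Complex.I • f p.1] p.2) ?_ ?_ (h0 _)
    · intro j l a b hjl
      obtain ⟨h1, h2⟩ := hf j l hjl
      fin_cases a <;> fin_cases b
      · exact h1
      · exact h2
      · change η (Complex.I • f j) (f l) = 0
        rw [hη.I_smul_left, h2, neg_zero]
      · change η (Complex.I • f j) (Complex.I • f l) = 0
        rw [hη.invariant, h1]
    · intro j
      change η (f j) (Complex.I • f j) ≠ 0
      induction j using Fin.cases with
      | zero => exact hne
      | succ j =>
        have : η (e j) (Complex.I • (e j : V)) = 1 := he j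
        exact ne_of_eq_of_ne this one_ne_zero
  · intro hflat
    choose π hπ hπ' using exists_horizontal_add_vertical hfib
    have hz := fun v w => hflat.apply_horizontal_left hfib hη (hπ' v) w
    refine pfaffian_eq_zero_of_factors η (n + 1) (A.ker.restrictScalars ℝ) ?_ π hπ fun v w => ?_
    · have : Module.finrank ℝ A.ker = 2 * Module.finrank ℂ A.ker := finrank_real_of_complex _
      change Module.finrank ℝ A.ker < _
      omega
    · have h1 := hz v w
      have h2 := hz w (π v)
      simp only [map_sub, LinearMap.sub_apply] at h1 h2
      rw [sub_eq_zero.1 h1, ← hη.alt.neg, sub_eq_zero.1 h2, hη.alt.neg]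

/-- If `η` vanishes on horizontal vectors, the squared length of `v` for `η + A^* θ` is the sum of
that of its vertical component for `η` and that of `A v` for `θ`. -/
theorem IsHorizontallyFlat.positive [FiniteDimensional ℂ V]
    (hfib : ∀ v, A v = 0 → v ≠ 0 → 0 < η v (Complex.I • v)) (hη : IsOneOneForm η)
    (hflat : IsHorizontallyFlat A η) (hpos : ∀ w, w ≠ 0 → 0 < θ w (Complex.I • w)) (v : V)
    (hv : v ≠ 0) : 0 < (η + pullbackForm A θ) v (Complex.I • v) := by
  obtain ⟨k, hk, h⟩ := exists_horizontal_add_vertical hfib v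
  have h1 := hflat.apply_horizontal_left hfib hη h (Complex.I • v)
  have h2 := hflat.apply_horizontal_left hfib hη h (Complex.I • k)
  rw [map_sub, LinearMap.sub_apply] at h1 h2
  rw [hη.apply_I_smul_comm v k] at h2
  have h3 : (η + pullbackForm A θ) v (Complex.I • v) =
      η k (Complex.I • k) + θ (A v) (Complex.I • A v) := by
    simp only [LinearMap.add_apply, pullbackForm_apply, map_smul]
    linarith
  rw [h3]
  rcases eq_or_ne (A v) 0 with hA | hA
  · have hvk : v = k := by
      by_contra hne
      have := hfib (v - k) (by rw [map_sub, hA, hk, sub_zero]) (sub_ne_zero.2 hne)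
      rw [hflat _ h] at this
      exact this.false
    rw [hA, ← hvk]
    simpa using hfib v hA hv
  · have := hpos _ hA
    rcases eq_or_ne k 0 with rfl | hk0
    · simpa using this
    · have := hfib k hk hk0
      linarith

/-- The map `A` preserves the dual metrics of `η + A^* θ` and `θ` if and only if `η` vanishes on
horizontal vectors. The horizontal vectors are those dual to covectors pulled back from the target,
and preservation of the dual metrics says that `A` is isometric on them; the metric of `η + A^* θ`
exceeds the pull-back of that of `θ` by `η(v, iv)`. -/
theorem isHorizontallyFlat_iff_formDual [FiniteDimensional ℂ V] [FiniteDimensional ℂ W]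
    (hA : Function.Surjective A)
    (hfib : ∀ v, A v = 0 → v ≠ 0 → 0 < η v (Complex.I • v)) (hη : IsOneOneForm η)
    (hpos : ∀ w, w ≠ 0 → 0 < θ w (Complex.I • w))
    (hpos' : ∀ v, v ≠ 0 → 0 < (η + pullbackForm A θ) v (Complex.I • v)) :
    IsHorizontallyFlat A η ↔ ∀ α β : W →ₗ[ℝ] ℝ,
      formDual (η + pullbackForm A θ) (α ∘ₗ A.restrictScalars ℝ) (β ∘ₗ A.restrictScalars ℝ) =
        formDual θ α β := by
  constructor
  · intro hflat α β
    -- the dual vector upstairs is the horizontal lift of the dual vector downstairs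
    obtain ⟨v, hv⟩ := hA (formSharp θ β)
    obtain ⟨k, hk, h⟩ := exists_horizontal_add_vertical hfib v
    have hAv : A (v - k) = formSharp θ β := by rw [map_sub, hk, sub_zero, hv]
    have hs : v - k = formSharp (η + pullbackForm A θ) (β ∘ₗ A.restrictScalars ℝ) := by
      refine eq_formSharp hpos' fun u => ?_
      rw [LinearMap.add_apply, LinearMap.add_apply, hflat.apply_horizontal_left hfib hη h,
        pullbackForm_apply, map_smul, hAv, formSharp_spec hpos]
      simp
    rw [formDual_eq hpos', ← hs, formDual_eq hpos]
    exact congrArg α hAv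
  · intro hdual v hv
    obtain ⟨s, hs⟩ := hA.hasRightInverse
    -- the covector dual to a horizontal vector descends to the base
    let γ : V →ₗ[ℝ] ℝ := (η + pullbackForm A θ) v ∘ₗ mulI V
    have hγ : ∀ k, A k = 0 → γ k = 0 := fun k hk => by
      simp [γ, hk, hv (Complex.I • k) (by rw [map_smul, hk, smul_zero])]
    have hγs : ∀ u, γ (s (A u)) = γ u := fun u => by
      have := hγ (s (A u) - u) (by rw [map_sub, hs, sub_self])
      rwa [map_sub, sub_eq_zero] at this
    let α : W →ₗ[ℝ] ℝ :=
      { toFun := fun w => γ (s w)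
        map_add' := fun w w' => by
          have : γ (s (w + w') - (s w + s w')) = 0 := hγ _ (by simp [hs _])
          rwa [map_sub, map_add, sub_eq_zero] at this
        map_smul' := fun c w => by
          have : γ (s (c • w) - c • s w) = 0 := hγ _ (by
            rw [map_sub, hs, LinearMap.map_smul_of_tower, hs, sub_self])
          rwa [map_sub, map_smul, sub_eq_zero] at this }
    have hα : v = formSharp (η + pullbackForm A θ) (α ∘ₗ A.restrictScalars ℝ) :=
      eq_formSharp hpos' fun u => (hγs u).symm
    -- every covector `β` takes the same value on both vectors, by the assumption on `β` and `α`;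
    -- pairing with their difference is one such `β`
    have hAv : A v = formSharp θ α := by
      by_contra hne
      refine (hpos _ (sub_ne_zero.2 hne)).ne' ?_
      have h1 := hdual (θ (A v - formSharp θ α) ∘ₗ mulI W) α
      rw [formDual_eq hpos', formDual_eq hpos, ← hα] at h1
      rw [smul_sub, map_sub, sub_eq_zero]
      exact h1
    -- both sides are squared norms, of `v` and of `A v`; they differ by `η(v, iv)`
    have h1 := hdual α α
    rw [formDual, formDual, ← hα, ← hAv] at h1
    simpa using h1

/-- Preserving the Poisson pairings is the same as preserving the dual metrics: replace `β` by
`β ∘ i`, which commutes with pull-back since `A` is complex linear. -/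
theorem formPoisson_iff_formDual [FiniteDimensional ℂ V] [FiniteDimensional ℂ W]
    {η : V →ₗ[ℝ] V →ₗ[ℝ] ℝ} (hη : IsOneOneForm η) (hθ : IsOneOneForm θ)
    (hpos : ∀ w, w ≠ 0 → 0 < θ w (Complex.I • w))
    (hpos' : ∀ v, v ≠ 0 → 0 < η v (Complex.I • v)) :
    (∀ α β : W →ₗ[ℝ] ℝ,
      formPoisson η (α ∘ₗ A.restrictScalars ℝ) (β ∘ₗ A.restrictScalars ℝ) = formPoisson θ α β) ↔
    ∀ α β : W →ₗ[ℝ] ℝ,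
      formDual η (α ∘ₗ A.restrictScalars ℝ) (β ∘ₗ A.restrictScalars ℝ) = formDual θ α β := by
  have hc : ∀ β : W →ₗ[ℝ] ℝ, (β ∘ₗ mulI W) ∘ₗ A.restrictScalars ℝ =
      (β ∘ₗ A.restrictScalars ℝ) ∘ₗ mulI V := fun β => by
    ext v; simp
  constructor
  · intro h α β
    rw [← formPoisson_comp_mulI hpos' hη, ← formPoisson_comp_mulI hpos hθ, ← hc, h]
  · intro h α β
    have hβ : β = (-(β ∘ₗ mulI W)) ∘ₗ mulI W := by
      ext w; simp [smul_smul]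
    rw [hβ, hc, formPoisson_comp_mulI hpos' hη, formPoisson_comp_mulI hpos hθ, h]

end Submersion

/-! ### Two-forms at a point of a complex manifold -/

section Pointwise

variable {E : Type*} [NormedAddCommGroup E] [NormedSpace ℂ E]
  {X : Type*} [TopologicalSpace X] [ChartedSpace E X]

/-- A two-form at a point as a bilinear form on the model space `E`, which is definitionally the
tangent space. The metric, the dual metric and the Poisson pairing of the two-form unfold to
`η(v, iw)`, `formDual` and `formPoisson` for this bilinear form `η`. -/
noncomputable def TwoForm.bilinAt (Ω : TwoForm E X) (x : X) : E →ₗ[ℝ] E →ₗ[ℝ] ℝ :=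
  let α : E [⋀^Fin 2]→L[ℝ] ℝ := Ω x
  have hu : ∀ v w z : E, Function.update ![v, w] 1 z = ![v, z] := fun v w z => by
    ext i; fin_cases i <;> rfl
  LinearMap.mk₂ ℝ (fun v w => α ![v, w])
    (fun v v' w => α.toMultilinearMap.cons_add ![w] v v')
    (fun c v w => α.toMultilinearMap.cons_smul ![w] c v)
    (fun v w w' => by simpa only [hu] using α.map_update_add ![v, w] 1 w w')
    (fun c v w => by simpa only [hu] using α.map_update_smul ![v, w] 1 c w)

theorem TwoForm.IsOneOneOn.isOneOneForm {Ω : TwoForm E X} {U : Set X} (h : Ω.IsOneOneOn U) {x : X}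
    (hx : x ∈ U) : IsOneOneForm (Ω.bilinAt x) where
  alt v := (Ω x).map_eq_zero_of_eq ![v, v] (i := 0) (j := 1) rfl (by decide)
  invariant v w := h x hx v w

theorem TwoForm.wedgePow_eq (Ω : TwoForm E X) (x : X) (k : ℕ) (v : Fin k × Fin 2 → E) :
    wedgePow (V := E) (Ω x) k v = 1 / 2 ^ k * pfaffian (Ω.bilinAt x) k v := by
  rw [pfaffian_apply]; rfl

theorem isPoissonKahler_iff (Ω : TwoForm E X) (n : ℕ) :
    IsPoissonKahler Ω n ↔ ∀ (x : X) v, pfaffian (Ω.bilinAt x) (n + 1) v = 0 := by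
  refine forall_congr' fun x => forall_congr' fun v => ?_
  refine (Eq.congr_left (Ω.wedgePow_eq x (n + 1) v)).trans ?_
  rw [mul_eq_zero, or_iff_right (by positivity)]

variable {F : Type*} [NormedAddCommGroup F] [NormedSpace ℂ F]
  {B : Type*} [TopologicalSpace B] [ChartedSpace F B]

/-- A map that is complex differentiable at a point is real differentiable there, with the same
derivative: the charts do not depend on the scalars. -/
theorem hasMFDerivAt_restrictScalars {f : X → B} {x : X}
    (h : MDifferentiableAt 𝓘(ℂ, E) 𝓘(ℂ, F) f x) :
    HasMFDerivAt 𝓘(ℝ, E) 𝓘(ℝ, F) f x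
      ((mfderiv 𝓘(ℂ, E) 𝓘(ℂ, F) f x : E →L[ℂ] F).restrictScalars ℝ) :=
  ⟨h.continuousAt, HasFDerivWithinAt.restrictScalars ℝ h.hasMFDerivAt.2⟩

/-- The differential of a holomorphic map as a complex-linear map of the model spaces. -/
noncomputable def complexPush (p : X → B) (x : X) : E →ₗ[ℂ] F :=
  let D : E →L[ℂ] F := mfderiv 𝓘(ℂ, E) 𝓘(ℂ, F) p x
  D

theorem push_eq_complexPush {p : X → B} {x : X} (h : MDifferentiableAt 𝓘(ℂ, E) 𝓘(ℂ, F) p x)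
    (v : E) : push E F p x v = complexPush (E := E) (F := F) p x v := by
  rw [push, (hasMFDerivAt_restrictScalars h).mfderiv]
  rfl

theorem bilinAt_add_pullback {p : X → B} {x : X} (h : MDifferentiableAt 𝓘(ℂ, E) 𝓘(ℂ, F) p x)
    (Ω : TwoForm E X) (Θ : TwoForm F B) : (Ω + Θ.pullback p).bilinAt x =
      Ω.bilinAt x + pullbackForm (complexPush (E := E) p x) (Θ.bilinAt (p x)) := by
  ext v w
  have : Θ.pullback p x ![v, w] = Θ (p x) ![push E F p x v, push E F p x w] := by
    refine congrArg (Θ (p x)) ?_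
    ext i; fin_cases i <;> rfl
  rw [push_eq_complexPush h, push_eq_complexPush h] at this
  exact congrArg (Ω x ![v, w] + ·) this

theorem IsProperHolomorphicSubmersion.mdifferentiableAt {p : X → B}
    (hp : IsProperHolomorphicSubmersion E F p) (x : X) :
    MDifferentiableAt 𝓘(ℂ, E) 𝓘(ℂ, F) p x :=
  (hp.holomorphic x).mdifferentiableAt (by simp)

theorem IsProperHolomorphicSubmersion.complexPush_surjective {p : X → B}
    (hp : IsProperHolomorphicSubmersion E F p) (x : X) :
    Function.Surjective (complexPush (E := E) (F := F) p x) := fun w => by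
  obtain ⟨v, hv⟩ := hp.submersion x w
  exact ⟨v, (push_eq_complexPush (hp.mdifferentiableAt x) v).symm.trans hv⟩

/-- The fibres have dimension `n`. -/
theorem IsProperHolomorphicSubmersion.finrank_ker_complexPush [FiniteDimensional ℂ E] {p : X → B}
    (hp : IsProperHolomorphicSubmersion E F p)
    {n : ℕ} (hn : Module.finrank ℂ E = Module.finrank ℂ F + n) (x : X) :
    Module.finrank ℂ (complexPush (E := E) (F := F) p x).ker = n := by
  have := LinearMap.finrank_range_add_finrank_ker (complexPush (E := E) (F := F) p x)
  rw [LinearMap.range_eq_top.2 (hp.complexPush_surjective x), finrank_top] at this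
  omega

end Pointwise

/-! ### Covectors as differentials -/

section Covectors

variable {F : Type*} [NormedAddCommGroup F] [NormedSpace ℂ F]
  {B : Type*} [TopologicalSpace B] [ChartedSpace F B]

/-- The smooth manifold underlying a complex manifold. -/
theorem isManifold_real [IsManifold 𝓘(ℂ, F) ω B] : IsManifold 𝓘(ℝ, F) ∞ B := by
  refine isManifold_of_contDiffOn _ _ _ fun e e' he he' => ?_
  have h := contMDiffOn_of_mem_contDiffGroupoid
    (HasGroupoid.compatible (G := contDiffGroupoid ω 𝓘(ℂ, F)) he he')
  have h' := (contMDiffOn_iff_contDiffOn.1 h).restrict_scalars ℝ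
  refine (h'.of_le le_top).congr_mono (fun _ _ => rfl) ?_
  simp

/-- Every covector at a point is the differential of a globally smooth function: a linear function
in a chart, cut off by a bump function. -/
theorem exists_contMDiff_differential_eq [T2Space B] [FiniteDimensional ℂ F]
    [IsManifold 𝓘(ℂ, F) ω B] (b : B) (α : F →L[ℝ] ℝ) :
    ∃ f : B → ℝ, ContMDiff 𝓘(ℝ, F) 𝓘(ℝ, ℝ) ∞ f ∧ differential f b = α := by
  have := FiniteDimensional.complexToReal F
  have := isManifold_real (F := F) (B := B)
  have : IsManifold 𝓘(ℝ, F) 1 B := .of_le (n := ∞) (by simp)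
  let e := chartAt F b
  have hb : b ∈ e.source := mem_chart_source F b
  have he := mdifferentiable_of_mem_atlas (I := 𝓘(ℝ, F)) (chart_mem_atlas F b)
  let D : F ≃L[ℝ] F := he.mfderiv hb
  let γ : F →L[ℝ] ℝ := α ∘L (D.symm : F →L[ℝ] F)
  obtain ⟨ρ⟩ : Nonempty (SmoothBumpFunction 𝓘(ℝ, F) b) := inferInstance
  refine ⟨fun y => ρ y • γ (e y), ρ.contMDiff_smul ?_, ?_⟩
  · exact γ.contMDiff.comp_contMDiffOn (contMDiffOn_chart (n := ∞))
  · have h1 : (fun y => ρ y • γ (e y)) =ᶠ[nhds b] γ ∘ e := by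
      filter_upwards [ρ.eventuallyEq_one] with y hy
      simp [hy]
    have h2 : HasMFDerivAt 𝓘(ℝ, F) 𝓘(ℝ, ℝ) (γ ∘ e) b (γ ∘L (D : F →L[ℝ] F)) :=
      (γ.hasMFDerivAt (x := e b)).comp b (he.mdifferentiableAt hb).hasMFDerivAt
    have h3 : differential (fun y => ρ y • γ (e y)) b = γ ∘L (D : F →L[ℝ] F) :=
      (h2.congr_of_eventuallyEq h1).mfderiv
    rw [h3]
    ext v
    exact congrArg α (D.symm_apply_apply v)

end Covectors

/-! ### Constant two-forms and their pull-backs -/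

section FlatForm

variable {F G : Type*} [NormedAddCommGroup F] [NormedSpace ℝ F]
  [NormedAddCommGroup G] [NormedSpace ℝ G]

/-- The alternating form `(v, w) ↦ β v w - β w v`. -/
noncomputable def antisymmetrization (β : F →L[ℝ] F →L[ℝ] ℝ) : F [⋀^Fin 2]→L[ℝ] ℝ :=
  ContinuousAlternatingMap.alternatizeUncurryFinCLM ℝ F ℝ
    ((ContinuousAlternatingMap.ofSubsingletonLIE (0 : Fin 1)).toContinuousLinearEquiv.toContinuousLinearMap
      ∘L β)

theorem antisymmetrization_apply (β : F →L[ℝ] F →L[ℝ] ℝ) (v : Fin 2 → F) :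
    antisymmetrization β v = β (v 0) (v 1) - β (v 1) (v 0) := by
  change ContinuousAlternatingMap.alternatizeUncurryFin _ v = _
  rw [ContinuousAlternatingMap.alternatizeUncurryFin_apply, Fin.sum_univ_two]
  simp [Fin.removeNth, sub_eq_add_neg]
  rfl

/-- The pull-back of a constant two-form is smooth in the linear map: it is the antisymmetrization
of an expression that is bilinear in `A`. -/
theorem contDiff_antisymmetrization_comp (β : F →L[ℝ] F →L[ℝ] ℝ) :
    ContDiff ℝ ∞ fun A : G →L[ℝ] F => (antisymmetrization β).compContinuousLinearMap A := by
  have h : (fun A : G →L[ℝ] F => (antisymmetrization β).compContinuousLinearMap A) = fun A =>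
      ContinuousAlternatingMap.alternatizeUncurryFinCLM ℝ G ℝ
        ((ContinuousAlternatingMap.ofSubsingletonLIE
          (0 : Fin 1)).toContinuousLinearEquiv.toContinuousLinearMap ∘L
          ((ContinuousLinearMap.compL ℝ G F ℝ).flip A ∘L (β ∘L A))) := by
    ext A v
    exact (antisymmetrization_apply β _).trans
      (antisymmetrization_apply (((ContinuousLinearMap.compL ℝ G F ℝ).flip A) ∘L (β ∘L A)) v).symm
  rw [h]
  refine (ContinuousLinearMap.contDiff _).comp (contDiff_const.clm_comp ?_)
  exact ((ContinuousLinearMap.contDiff _).clm_comp (contDiff_const.clm_comp contDiff_id))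

theorem extDeriv_pullback_const {k : ℕ} (α : F [⋀^Fin k]→L[ℝ] ℝ) {f : G → F} {y : G}
    (hf : ContDiffAt ℝ ∞ f y) :
    extDeriv (fun x => α.compContinuousLinearMap (fderiv ℝ f x)) y = 0 := by
  have h0 : extDeriv (fun _ : F => α) (f y) = 0 := by
    rw [extDeriv, fderiv_const_apply]
    exact map_zero (ContinuousAlternatingMap.alternatizeUncurryFinCLM ℝ F ℝ)
  rw [extDeriv_pullback (differentiableAt_const α) (hf.of_le (m := 2) ENat.LEInfty.out) (by simp),
    h0]
  rfl

end FlatForm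

/-! ### Local existence of Kähler forms -/

section LocalKahler

variable {F : Type*} [NormedAddCommGroup F] [NormedSpace ℂ F]

/-- A positive `(1,1)`-form on a complex vector space: for any real inner product `g`, take
`g(iv, w) - g(iw, v)`. -/
theorem exists_flat_kahler [FiniteDimensional ℂ F] : ∃ β : F →L[ℝ] F →L[ℝ] ℝ,
    (∀ v w, antisymmetrization β ![Complex.I • v, Complex.I • w] = antisymmetrization β ![v, w]) ∧
    ∀ v, v ≠ 0 → 0 < antisymmetrization β ![v, Complex.I • v] := by
  have := FiniteDimensional.complexToReal F
  let L : F ≃L[ℝ] EuclideanSpace ℝ (Fin (Module.finrank ℝ F)) := toEuclidean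
  let JF : F →L[ℝ] F := Complex.I • ContinuousLinearMap.id ℝ F
  let β : F →L[ℝ] F →L[ℝ] ℝ := (innerSL ℝ).bilinearComp
    (L.toContinuousLinearMap ∘L JF) L.toContinuousLinearMap
  have hβ : ∀ v w, β v w = inner ℝ (L (Complex.I • v)) (L w) := fun v w => rfl
  have hJ : ∀ v : F, Complex.I • Complex.I • v = -v := fun v => by simp [smul_smul]
  refine ⟨β, fun v w => ?_, fun v hv => ?_⟩
  · simp only [antisymmetrization_apply, hβ, Matrix.cons_val_zero, Matrix.cons_val_one, hJ,
      map_neg, inner_neg_left]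
    rw [real_inner_comm (L v), real_inner_comm (L w)]
    ring
  · simp only [antisymmetrization_apply, hβ, Matrix.cons_val_zero, Matrix.cons_val_one, hJ,
      map_neg, inner_neg_left]
    have h1 : 0 < inner ℝ (L v) (L v) := real_inner_self_pos.2 (by simpa using hv)
    have h2 : 0 ≤ inner ℝ (L (Complex.I • v)) (L (Complex.I • v)) := real_inner_self_nonneg
    linarith

variable {B : Type*} [TopologicalSpace B] [ChartedSpace F B]

/-- Every point of a complex manifold has a neighbourhood with a Kähler form: the pull-back of a
constant one under a chart. -/
theorem exists_isKahlerOn [FiniteDimensional ℂ F] [IsManifold 𝓘(ℂ, F) ω B] (b : B) :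
    ∃ (U : Set B) (Θ : TwoForm F B), IsOpen U ∧ b ∈ U ∧ Θ.IsKahlerOn U := by
  have := isManifold_real (F := F) (B := B)
  have : IsManifold 𝓘(ℝ, F) 1 B := .of_le (n := ∞) (by simp)
  have : IsManifold 𝓘(ℂ, F) 1 B := .of_le (n := ω) (by simp)
  obtain ⟨β, hβJ, hβ⟩ := exists_flat_kahler (F := F)
  let e₀ := chartAt F b
  have he₀ := mdifferentiable_of_mem_atlas (I := 𝓘(ℝ, F)) (chart_mem_atlas F b)
  have he₀' := mdifferentiable_of_mem_atlas (I := 𝓘(ℂ, F)) (chart_mem_atlas F b)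
  let D : B → F →L[ℝ] F := fun y => mfderiv 𝓘(ℝ, F) 𝓘(ℝ, F) e₀ y
  let Θ : TwoForm F B := fun y =>
    ((antisymmetrization β).compContinuousLinearMap (D y) : F [⋀^Fin 2]→L[ℝ] ℝ)
  have hΘ : ∀ y (v w : F), Θ y ![v, w] = antisymmetrization β ![D y v, D y w] := fun y v w => by
    refine congrArg (antisymmetrization β) ?_
    ext i; fin_cases i <;> rfl
  have hD : ∀ y ∈ e₀.source, ∀ v : F, D y (Complex.I • v) = Complex.I • D y v := fun y hy v => by
    have h := (hasMFDerivAt_restrictScalars (he₀'.mdifferentiableAt hy)).mfderiv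
    let D' : F →L[ℂ] F := mfderiv 𝓘(ℂ, F) 𝓘(ℂ, F) e₀ y
    have h' : D y = D'.restrictScalars ℝ := h
    rw [h']
    exact D'.map_smul Complex.I v
  -- in another chart, the form is the pull-back of a constant form under the transition map
  have hchart : ∀ e ∈ atlas F B, ∀ y ∈ e.target ∩ e.symm ⁻¹' e₀.source,
      Θ.inChart e y =
        (antisymmetrization β).compContinuousLinearMap (fderiv ℝ (e₀ ∘ e.symm) y) := by
    intro e he y hy
    have hc := mfderiv_comp y (he₀.mdifferentiableAt hy.2)
      ((mdifferentiable_of_mem_atlas (I := 𝓘(ℝ, F)) he).mdifferentiableAt_symm hy.1)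
    rw [mfderiv_eq_fderiv] at hc
    rw [hc]
    rfl
  have hopen : ∀ e : OpenPartialHomeomorph B F, IsOpen (e.target ∩ e.symm ⁻¹' e₀.source) :=
    fun e => e.isOpen_inter_preimage_symm e₀.open_source
  have hsmooth : ∀ e ∈ atlas F B,
      ContDiffOn ℝ ∞ (e₀ ∘ e.symm) (e.target ∩ e.symm ⁻¹' e₀.source) := fun e he =>
    contMDiffOn_iff_contDiffOn.1 <| contMDiffOn_of_mem_contDiffGroupoid <|
      HasGroupoid.compatible (G := contDiffGroupoid ∞ 𝓘(ℝ, F)) he (chart_mem_atlas F b)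
  refine ⟨e₀.source, Θ, e₀.open_source, mem_chart_source F b, ?_, ?_, ?_, ?_⟩
  · intro e he
    refine ContDiffOn.congr ?_ (hchart e he)
    exact (contDiff_antisymmetrization_comp β).comp_contDiffOn
      ((hsmooth e he).fderiv_of_isOpen (hopen e) (by simp))
  · intro e he y hy
    have hev : Θ.inChart e =ᶠ[nhds y] fun y =>
        (antisymmetrization β).compContinuousLinearMap (fderiv ℝ (e₀ ∘ e.symm) y) :=
      Filter.eventually_of_mem ((hopen e).mem_nhds hy) (hchart e he)
    rw [hev.extDeriv_eq]
    exact extDeriv_pullback_const _ ((hsmooth e he).contDiffAt ((hopen e).mem_nhds hy))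
  · intro y hy (v : F) (w : F)
    change Θ y ![Complex.I • v, Complex.I • w] = _
    refine (hΘ y _ _).trans (Eq.trans ?_ (hΘ y v w).symm)
    rw [hD y hy, hD y hy, hβJ]
  · intro y hy (v : F) hv
    refine lt_of_lt_of_eq (hβ (D y v) ?_) (Eq.trans ?_ (hΘ y v (Complex.I • v)).symm)
    · intro h0
      exact hv (he₀.mfderiv_injective hy (h0.trans (map_zero (D y)).symm))
    · rw [hD y hy]

end LocalKahler

/-! ### Poisson conditions as conditions on covectors -/

section Metric

variable {E : Type*} [NormedAddCommGroup E] [NormedSpace ℂ E]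
  {F : Type*} [NormedAddCommGroup F] [NormedSpace ℂ F]
  {X : Type*} [TopologicalSpace X] [ChartedSpace E X]
  {B : Type*} [TopologicalSpace B] [ChartedSpace F B]

/-- No positivity is needed: whatever vector is chosen as dual to the zero covector, it pairs to
zero with everything. -/
theorem TwoForm.realDualMetric_zero_zero (Ω : TwoForm E X) (x : X) :
    Ω.realDualMetric x 0 0 = 0 :=
  Classical.epsilon_spec (p := fun V : RealTangent E x => ∀ u : RealTangent E x,
    Ω.metric x V u = (0 : RealTangent E x →L[ℝ] ℝ) u)
    ⟨0, fun u => LinearMap.map_zero₂ (Ω.bilinAt x) (J E x u)⟩ _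

/-- On real covectors, the `𝕜`-valued dual metric restricts to the real one. -/
theorem re_dualMetric_ofReal (𝕜 : Type*) [RCLike 𝕜] (Ω : TwoForm E X) (x : X)
    (α β : RealTangent E x →L[ℝ] ℝ) :
    RCLike.re (Ω.dualMetric x ((RCLike.ofRealCLM (K := 𝕜)).comp α)
      ((RCLike.ofRealCLM (K := 𝕜)).comp β)) = Ω.realDualMetric x α β := by
  have hre : ∀ γ : RealTangent E x →L[ℝ] ℝ,
      RCLike.reCLM.comp ((RCLike.ofRealCLM (K := 𝕜)).comp γ) = γ := fun γ => by ext v; simp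
  have him : ∀ γ : RealTangent E x →L[ℝ] ℝ,
      RCLike.imCLM.comp ((RCLike.ofRealCLM (K := 𝕜)).comp γ) = 0 := fun γ => by ext v; simp
  simp only [TwoForm.dualMetric, hre, him, Ω.realDualMetric_zero_zero]
  simp

/-- Preservation of the dual metrics is a condition on real covectors at single points, whatever
the scalars `𝕜` and the open set on which the functions live. -/
theorem isMetricPoissonOn_iff [T2Space B] [FiniteDimensional ℂ F]
    [IsManifold 𝓘(ℂ, F) ω B] (𝕜 : Type*) [RCLike 𝕜] (p : X → B) (U : Set B)
    (Ω : TwoForm E X) (Θ : TwoForm F B) : IsMetricPoissonOn 𝕜 p U Ω Θ ↔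
      ∀ x ∈ p ⁻¹' U, ∀ α β : RealTangent F (p x) →L[ℝ] ℝ,
        Ω.realDualMetric x (ContinuousLinearMap.comp α (push E F p x))
          (ContinuousLinearMap.comp β (push E F p x)) = Θ.realDualMetric (p x) α β := by
  constructor
  · intro h x hx α β
    obtain ⟨f, hf, rfl⟩ := exists_contMDiff_differential_eq (F := F) (p x) α
    obtain ⟨g, hg, rfl⟩ := exists_contMDiff_differential_eq (F := F) (p x) β
    have hsm : ∀ f : B → ℝ, ContMDiff 𝓘(ℝ, F) 𝓘(ℝ, ℝ) ∞ f →
        ContMDiffOn 𝓘(ℝ, F) 𝓘(ℝ, 𝕜) ∞ (RCLike.ofRealCLM (K := 𝕜) ∘ f) U ∧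
        differential (RCLike.ofRealCLM (K := 𝕜) ∘ f) (p x) =
          (RCLike.ofRealCLM (K := 𝕜)).comp (differential f (p x)) := fun f hf =>
      ⟨((RCLike.ofRealCLM (K := 𝕜)).contMDiff.comp hf).contMDiffOn,
        ((RCLike.ofRealCLM (K := 𝕜)).hasMFDerivAt.comp (p x)
          ((hf (p x)).mdifferentiableAt (by simp)).hasMFDerivAt).mfderiv⟩
    have := congrArg RCLike.re (h _ _ (hsm f hf).1 (hsm g hg).1 x hx)
    rw [(hsm f hf).2, (hsm g hg).2, re_dualMetric_ofReal] at this
    exact (re_dualMetric_ofReal 𝕜 Ω x _ _).symm.trans this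
  · intro h f g _ _ x hx
    have key : ∀ a b : 𝕜 →L[ℝ] ℝ,
        Ω.realDualMetric x (a.comp ((differential f (p x)).comp (push E F p x)))
          (b.comp ((differential g (p x)).comp (push E F p x))) =
        Θ.realDualMetric (p x) (a.comp (differential f (p x))) (b.comp (differential g (p x))) :=
      fun a b => h x hx (a.comp (differential f (p x))) (b.comp (differential g (p x)))
    simp only [TwoForm.dualMetric, key]

theorem isPoissonMap_iff [T2Space B] [FiniteDimensional ℂ F]
    [IsManifold 𝓘(ℂ, F) ω B] (p : X → B)
    (Ω : TwoForm E X) (Θ : TwoForm F B) : IsPoissonMap p Ω Θ ↔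
      ∀ x, ∀ α β : F →L[ℝ] ℝ,
        Ω.poissonPairing x (ContinuousLinearMap.comp α (push E F p x))
          (ContinuousLinearMap.comp β (push E F p x)) = Θ.poissonPairing (p x) α β := by
  constructor
  · intro h x α β
    obtain ⟨f, hf, rfl⟩ := exists_contMDiff_differential_eq (F := F) (p x) α
    obtain ⟨g, hg, rfl⟩ := exists_contMDiff_differential_eq (F := F) (p x) β
    exact h f g hf hg x
  · intro h f g _ _ x
    exact h x _ _

end Metric

/-! ### Proper holomorphic submersions -/

section Fibration

variable {E : Type*} [NormedAddCommGroup E] [NormedSpace ℂ E]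
  {F : Type*} [NormedAddCommGroup F] [NormedSpace ℂ F]
  {X : Type*} [TopologicalSpace X] [ChartedSpace E X]
  {B : Type*} [TopologicalSpace B] [ChartedSpace F B]
  {n : ℕ} {p : X → B}

/-- Quantifying over covectors of the base and their pull-backs under the real differential of `p`
is quantifying over linear functionals and their composites with the complex differential. -/
theorem forall_covector_iff [FiniteDimensional ℂ F] (hp : IsProperHolomorphicSubmersion E F p)
    (x : X)
    (P : (E →ₗ[ℝ] ℝ) → (E →ₗ[ℝ] ℝ) → (F →ₗ[ℝ] ℝ) → (F →ₗ[ℝ] ℝ) → Prop) :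
    (∀ α β : RealTangent F (p x) →L[ℝ] ℝ,
      P (α.comp (push E F p x)).toLinearMap (β.comp (push E F p x)).toLinearMap
        α.toLinearMap β.toLinearMap) ↔
    ∀ α β : F →ₗ[ℝ] ℝ, P (α ∘ₗ (complexPush (E := E) p x).restrictScalars ℝ)
      (β ∘ₗ (complexPush (E := E) p x).restrictScalars ℝ) α β := by
  have := FiniteDimensional.complexToReal F
  have hcomp : ∀ α : F →L[ℝ] ℝ, (α.comp (push E F p x : E →L[ℝ] F)).toLinearMap =
      α.toLinearMap ∘ₗ (complexPush (E := E) p x).restrictScalars ℝ := fun α => by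
    ext v
    exact congrArg α (push_eq_complexPush (hp.mdifferentiableAt x) v)
  constructor
  · intro h α β
    let α' : F →L[ℝ] ℝ := LinearMap.toContinuousLinearMap α
    let β' : F →L[ℝ] ℝ := LinearMap.toContinuousLinearMap β
    have h' : P (α'.comp (push E F p x : E →L[ℝ] F)).toLinearMap
      (β'.comp (push E F p x : E →L[ℝ] F)).toLinearMap α'.toLinearMap β'.toLinearMap := h α' β'
    rw [hcomp, hcomp] at h'
    exact h'
  · intro h α β
    have h' := h α.toLinearMap β.toLinearMap
    rw [← hcomp α, ← hcomp β] at h'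
    exact h'

variable [FiniteDimensional ℂ E]

theorem isPoissonKahler_iff_isHorizontallyFlat
    (hn : Module.finrank ℂ E = Module.finrank ℂ F + n) (hp : IsProperHolomorphicSubmersion E F p)
    {Ω : TwoForm E X} (hΩ : ∀ x, IsOneOneForm (Ω.bilinAt x))
    (hfib : ∀ x v, complexPush (E := E) (F := F) p x v = 0 → v ≠ 0 →
      0 < Ω.bilinAt x v (Complex.I • v)) :
    IsPoissonKahler Ω n ↔
      ∀ x, IsHorizontallyFlat (complexPush (E := E) (F := F) p x) (Ω.bilinAt x) := by
  rw [isPoissonKahler_iff]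
  exact forall_congr' fun x =>
    pfaffian_eq_zero_iff_isHorizontallyFlat (hfib x) (hΩ x) (hp.finrank_ker_complexPush hn x)

variable [FiniteDimensional ℂ F]

/-- At a point `x`, the differential of `p` preserves the dual metrics of `Ω + p^* Θ` and `Θ` if and
only if `Ω` vanishes on the horizontal vectors. -/
theorem isHorizontallyFlat_iff_realDualMetric (hp : IsProperHolomorphicSubmersion E F p)
    {Ω : TwoForm E X} {Θ : TwoForm F B} {U : Set B} {x : X} (hx : p x ∈ U)
    (hΩ : IsOneOneForm (Ω.bilinAt x))
    (hfib : ∀ v, complexPush (E := E) (F := F) p x v = 0 → v ≠ 0 →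
      0 < Ω.bilinAt x v (Complex.I • v))
    (hΘ : Θ.IsKahlerOn U) (hpos : (Ω + Θ.pullback p).PositiveOn (p ⁻¹' U)) :
    IsHorizontallyFlat (complexPush (E := E) (F := F) p x) (Ω.bilinAt x) ↔
      ∀ α β : RealTangent F (p x) →L[ℝ] ℝ,
        (Ω + Θ.pullback p).realDualMetric x (α.comp (push E F p x)) (β.comp (push E F p x)) =
          Θ.realDualMetric (p x) α β := by
  have hpos' := hpos x hx
  have hb := bilinAt_add_pullback (hp.mdifferentiableAt x) Ω Θ
  refine Iff.trans ?_ (forall_covector_iff hp x fun α' β' α β =>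
    formDual ((Ω + Θ.pullback p).bilinAt x) α' β' = formDual (Θ.bilinAt (p x)) α β).symm
  rw [hb]
  exact isHorizontallyFlat_iff_formDual (hp.complexPush_surjective x) hfib hΩ
    (hΘ.positive (p x) hx) (fun v hv => hb ▸ hpos' v hv)

theorem poissonPairing_iff_realDualMetric (hp : IsProperHolomorphicSubmersion E F p)
    {Ω : TwoForm E X} {Θ : TwoForm F B} (hΩ : Ω.IsKahlerOn Set.univ)
    (hΘ : Θ.IsKahlerOn Set.univ) (x : X) :
    (∀ α β : RealTangent F (p x) →L[ℝ] ℝ,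
      Ω.poissonPairing x (α.comp (push E F p x)) (β.comp (push E F p x)) =
        Θ.poissonPairing (p x) α β) ↔
    ∀ α β : RealTangent F (p x) →L[ℝ] ℝ,
      Ω.realDualMetric x (α.comp (push E F p x)) (β.comp (push E F p x)) =
        Θ.realDualMetric (p x) α β :=
  (forall_covector_iff hp x fun α' β' α β =>
    formPoisson (Ω.bilinAt x) α' β' = formPoisson (Θ.bilinAt (p x)) α β).trans <|
  (formPoisson_iff_formDual (hΩ.oneOne.isOneOneForm trivial) (hΘ.oneOne.isOneOneForm trivial)
    (hΘ.positive _ trivial) (hΩ.positive _ trivial)).trans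
  (forall_covector_iff hp x fun α' β' α β =>
    formDual (Ω.bilinAt x) α' β' = formDual (Θ.bilinAt (p x)) α β).symm

theorem isPoissonKahler_iff_forall_isMetricPoissonOn [T2Space B] [IsManifold 𝓘(ℂ, F) ω B]
    (𝕜 : Type*) [RCLike 𝕜] (hn : Module.finrank ℂ E = Module.finrank ℂ F + n) {Ω : TwoForm E X}
    (h : IsRelativeKahlerFibration (F := F) p Ω) :
    IsPoissonKahler Ω n ↔ ∀ (U : Set B) (Θ : TwoForm F B), IsOpen U → Θ.IsKahlerOn U →
      (Ω + Θ.pullback p).PositiveOn (p ⁻¹' U) ∧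
        IsMetricPoissonOn 𝕜 p U (Ω + Θ.pullback p) Θ := by
  have hp := h.toIsProperHolomorphicSubmersion
  have hΩ : ∀ x, IsOneOneForm (Ω.bilinAt x) := fun x => h.oneOne.isOneOneForm trivial
  have hfib : ∀ x v, complexPush (E := E) (F := F) p x v = 0 → v ≠ 0 →
      0 < Ω.bilinAt x v (Complex.I • v) := fun x v hv =>
    h.fibrePositive x v ((push_eq_complexPush (hp.mdifferentiableAt x) v).trans hv)
  rw [isPoissonKahler_iff_isHorizontallyFlat hn hp hΩ hfib]
  constructor
  · intro hflat U Θ _ hΘ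
    have hpos : (Ω + Θ.pullback p).PositiveOn (p ⁻¹' U) := fun x hx v hv => by
      have := (hflat x).positive (θ := Θ.bilinAt (p x)) (hfib x) (hΩ x) (hΘ.positive (p x) hx) v hv
      rw [← bilinAt_add_pullback (hp.mdifferentiableAt x)] at this
      exact this
    exact ⟨hpos, (isMetricPoissonOn_iff 𝕜 p U _ Θ).2 fun x hx =>
      (isHorizontallyFlat_iff_realDualMetric hp hx (hΩ x) (hfib x) hΘ hpos).1 (hflat x)⟩
  · intro hall x
    obtain ⟨U, Θ, hU, hx, hΘ⟩ := exists_isKahlerOn (F := F) (p x)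
    obtain ⟨hpos, hmet⟩ := hall U Θ hU hΘ
    exact (isHorizontallyFlat_iff_realDualMetric hp hx (hΩ x) (hfib x) hΘ hpos).2
      ((isMetricPoissonOn_iff 𝕜 p U _ Θ).1 hmet x hx)

theorem isMetricPoissonOn_iff_isPoissonKahler_sub [T2Space B] [IsManifold 𝓘(ℂ, F) ω B]
    (𝕜 : Type*) [RCLike 𝕜] (hn : Module.finrank ℂ E = Module.finrank ℂ F + n)
    {Ω : TwoForm E X} {Θ : TwoForm F B} (hp : IsProperHolomorphicSubmersion E F p)
    (hΩ : Ω.IsKahlerOn Set.univ) (hΘ : Θ.IsKahlerOn Set.univ) :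
    IsMetricPoissonOn 𝕜 p Set.univ Ω Θ ↔ IsPoissonKahler (Ω - Θ.pullback p) n := by
  have hadd : Ω - Θ.pullback p + Θ.pullback p = Ω := sub_add_cancel _ _
  have hb : ∀ x, (Ω - Θ.pullback p).bilinAt x =
      Ω.bilinAt x - pullbackForm (complexPush (E := E) p x) (Θ.bilinAt (p x)) := fun x => by
    have h := bilinAt_add_pullback (hp.mdifferentiableAt x) (Ω - Θ.pullback p) Θ
    rw [hadd] at h
    rw [h]
    ext v w
    simp
  have h11 : ∀ x, IsOneOneForm ((Ω - Θ.pullback p).bilinAt x) := fun x => by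
    rw [hb]
    exact (hΩ.oneOne.isOneOneForm trivial).sub (hΘ.oneOne.isOneOneForm trivial).pullbackForm
  have hfib : ∀ x v, complexPush (E := E) (F := F) p x v = 0 → v ≠ 0 →
      0 < (Ω - Θ.pullback p).bilinAt x v (Complex.I • v) := fun x v hv hv0 => by
    have : 0 < Ω.bilinAt x v (Complex.I • v) := hΩ.positive x trivial v hv0
    rw [hb]
    simpa [hv] using this
  have hpos : (Ω - Θ.pullback p + Θ.pullback p).PositiveOn (p ⁻¹' Set.univ) := by
    rw [hadd]
    exact hΩ.positive
  rw [isPoissonKahler_iff_isHorizontallyFlat hn hp h11 hfib, isMetricPoissonOn_iff]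
  refine forall_congr' fun x => ?_
  rw [isHorizontallyFlat_iff_realDualMetric hp (Set.mem_univ _) (h11 x) (hfib x) hΘ hpos, hadd]
  exact forall_prop_of_true trivial

theorem isPoissonMap_iff_isMetricPoissonOn [T2Space B] [IsManifold 𝓘(ℂ, F) ω B]
    (𝕜 : Type*) [RCLike 𝕜] {Ω : TwoForm E X} {Θ : TwoForm F B}
    (hp : IsProperHolomorphicSubmersion E F p)
    (hΩ : Ω.IsKahlerOn Set.univ) (hΘ : Θ.IsKahlerOn Set.univ) :
    IsPoissonMap p Ω Θ ↔ IsMetricPoissonOn 𝕜 p Set.univ Ω Θ := by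
  rw [isPoissonMap_iff, isMetricPoissonOn_iff]
  exact forall_congr' fun x =>
    (poissonPairing_iff_realDualMetric hp hΩ hΘ x).trans ⟨fun h _ => h, fun h => h trivial⟩

end Fibration

end PoissonKahler

theorem mainTheorem7
    {E : Type*} [NormedAddCommGroup E] [NormedSpace ℂ E] [FiniteDimensional ℂ E]
    {F : Type*} [NormedAddCommGroup F] [NormedSpace ℂ F] [FiniteDimensional ℂ F]
    {X : Type*} [TopologicalSpace X] [T2Space X] [ChartedSpace E X] [IsManifold 𝓘(ℂ, E) ω X]
    {B : Type*} [TopologicalSpace B] [T2Space B] [ChartedSpace F B] [IsManifold 𝓘(ℂ, F) ω B]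
    (𝕜 : Type*) [RCLike 𝕜]
    (n : ℕ) (hn : Module.finrank ℂ E = Module.finrank ℂ F + n) (p : X → B) :
    (∀ Ω : TwoForm E X, IsRelativeKahlerFibration (F := F) p Ω →
      (IsPoissonKahler Ω n ↔
        ∀ (U : Set B) (Θ : TwoForm F B), IsOpen U → Θ.IsKahlerOn U →
          (Ω + Θ.pullback p).PositiveOn (p ⁻¹' U) ∧
            IsMetricPoissonOn 𝕜 p U (Ω + Θ.pullback p) Θ)) ∧
    (∀ (Ω : TwoForm E X) (Θ : TwoForm F B), IsProperHolomorphicSubmersion E F p →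
      Ω.IsKahlerOn Set.univ → Θ.IsKahlerOn Set.univ →
      (IsPoissonMap p Ω Θ ↔ IsPoissonKahler (Ω - Θ.pullback p) n) ∧
      (IsMetricPoissonOn 𝕜 p Set.univ Ω Θ ↔ IsPoissonKahler (Ω - Θ.pullback p) n)) :=
  ⟨fun _ h => isPoissonKahler_iff_forall_isMetricPoissonOn 𝕜 hn h, fun _ _ hp hΩ hΘ =>
    have h := isMetricPoissonOn_iff_isPoissonKahler_sub 𝕜 hn hp hΩ hΘ
    ⟨(isPoissonMap_iff_isMetricPoissonOn 𝕜 hp hΩ hΘ).trans h, h⟩⟩
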